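/- **A Narayana refinement of the Chan–Robbins–Yuen constant term identity (Conjecture 2 of Chan, Robbins and Yuen).** For a rational function $f$ of a variable $z$ (with coefficients in the field of rational functions over $\mathbb{Q}$ in the other variables), let $CT_z f$ denote the coefficient of $z^0$ in the formal Laurent expansion of $f$ in $z$ at $z=0$. Put $N(n,k)=\frac1n\binom nk\binom n{k-1}$ for $k\ge 1$ and $N(n,0)=0$ (Narayana numbers). Then for all integers $n\ge 1$ and $k\ge 0$ $$ CT_t\, t^{-k}\, CT_{x_n}\cdots CT_{x_1}\ \prod_{i=1}^n (1-x_i)^{-1}\Bigl(t+\frac{x_i}{1-x_i}\Bigr)\prod_{1\le i<j\le n}(x_j-x_i)^{-1} \;=\;N(n,k)\prod_{i=1}^{n-1}\frac1{i+1}\binom{2i}{i}. $$ Equivalently, in terms of triangular arrays: the set of arrays $(a_{ij})_{1\le i\le j\le n}$ of nonnegative integers such that $$a_{ii}+a_{i,i+1}+\cdots+a_{in}\ \le\ (i-1)+a_{1i}+a_{2i}+\cdots+a_{i-1,i}\qquad(1\le i\le n)$$ and such that exactly $k$ of the diagonal entries $a_{11},\dots,a_{nn}$ are $0$ is finite, and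 its cardinality is also $N(n,k)\prod_{i=1}^{n-1}\frac1{i+1}\binom{2i}{i}$. -/

import Mathlib

/-- The field `ℚ(x_s : s ∈ σ)` of rational functions over `ℚ` in the variables indexed by `σ`. -/
abbrev RatField (σ : Type) : Type := FractionRing (MvPolynomial σ ℚ)

namespace RatField

/-- The variable `x_s` as a rational function. -/
noncomputable def var {σ : Type} (s : σ) : RatField σ :=
  algebraMap (MvPolynomial σ ℚ) (RatField σ) (MvPolynomial.X s)

open Classical in
/-- A polynomial in the variables `x_s`, rewritten as a polynomial in the single variable `x_s`
whose coefficients involve only the other variables. -/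
noncomputable def single {σ : Type} (s : σ) :
    MvPolynomial σ ℚ →ₐ[ℚ] Polynomial (RatField σ) :=
  MvPolynomial.aeval fun r => if r = s then Polynomial.X else Polynomial.C (var r)

theorem eval_single {σ : Type} (s : σ) (p : MvPolynomial σ ℚ) :
    (single s p).eval (var s) = algebraMap (MvPolynomial σ ℚ) (RatField σ) p := by
  induction p using MvPolynomial.induction_on with
  | C a =>
    rw [← MvPolynomial.algebraMap_eq, AlgHom.commutes, Polynomial.algebraMap_apply,
      Polynomial.eval_C, ← IsScalarTower.algebraMap_apply]
  | add p q hp hq => rw [map_add, Polynomial.eval_add, hp, hq, map_add]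
  | mul_X p r hp =>
    rw [map_mul, Polynomial.eval_mul, hp, map_mul]
    congr 1
    by_cases h : r = s <;> simp [single, h, var]

/-- The same polynomial, as a formal Laurent series in `x_s`. -/
noncomputable def singleLaurent {σ : Type} (s : σ) :
    MvPolynomial σ ℚ →+* LaurentSeries (RatField σ) :=
  ((HahnSeries.ofPowerSeries ℤ (RatField σ)).comp Polynomial.coeToPowerSeries.ringHom).comp
    (single s).toRingHom

theorem singleLaurent_injective {σ : Type} (s : σ) :
    Function.Injective (singleLaurent s) := by
  have h1 : Function.Injective (single s) := fun p q h =>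
    IsFractionRing.injective (MvPolynomial σ ℚ) (RatField σ) (by
      rw [← eval_single s p, h, eval_single s q])
  exact (HahnSeries.ofPowerSeries_injective.comp (Polynomial.coe_injective (RatField σ))).comp h1

/-- The formal Laurent expansion at `x_s = 0` of a rational function in the variable `x_s`, the
other variables being treated as constants: the unique field embedding with `x_s ↦ X` and
`x_r ↦ C x_r` for `r ≠ s`. -/
noncomputable def laurent {σ : Type} (s : σ) : RatField σ →+* LaurentSeries (RatField σ) :=
  IsFractionRing.lift (singleLaurent_injective s)

/-- `CT_{x_s} f`: the coefficient of `x_s ^ 0` in the formal Laurent expansion of `f` in `x_s`. It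
is again a rational function (in the remaining variables). -/
noncomputable def CT {σ : Type} (s : σ) (f : RatField σ) : RatField σ :=
  (laurent s f).coeff 0

/-- `CT_{x_n} ⋯ CT_{x_1} f`, the variables `x_1, …, x_n` being `var (some i)` for `i : Fin n` in
increasing order: `CT_{x_1}` is applied first and `CT_{x_n}` last. -/
noncomputable def iterCT {n : ℕ} (f : RatField (Option (Fin n))) : RatField (Option (Fin n)) :=
  (List.finRange n).foldl (fun g i => CT (some i) g) f

/-- The rational function
`∏_i (1 - x_i)⁻¹ (t + x_i / (1 - x_i)) ∏_{i < j} (x_j - x_i)⁻¹` in `t = var none` and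
`x_i = var (some i)`. -/
noncomputable def integrand (n : ℕ) : RatField (Option (Fin n)) :=
  (∏ i : Fin n, (1 - var (some i))⁻¹ * (var none + var (some i) / (1 - var (some i)))) *
    ∏ j : Fin n, ∏ i ∈ Finset.Iio j, (var (some j) - var (some i))⁻¹

end RatField

/-- The Narayana number `N(n, k) = (1 / n) * binom(n, k) * binom(n, k - 1)`, with `N(n, 0) = 0`. -/
def narayanaNumber (n : ℕ) : ℕ → ℚ
  | 0 => 0
  | k + 1 => (1 / n : ℚ) * (n.choose (k + 1) : ℚ) * (n.choose k : ℚ)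

/-- The triangular arrays `(a_{ij})_{1 ≤ i ≤ j ≤ n}` of nonnegative integers with
`a_{ii} + a_{i,i+1} + ⋯ + a_{in} ≤ (i - 1) + a_{1i} + ⋯ + a_{i-1,i}` for every `i`, extended by `0`
below the diagonal. Indices in `Fin n` start at `0`, so `i - 1` reads `(i : ℕ)`. -/
def triangularArrays (n : ℕ) : Set (Fin n → Fin n → ℕ) :=
  {a | (∀ i j, j < i → a i j = 0) ∧
    ∀ i, ∑ j ∈ Finset.Ici i, a i j ≤ (i : ℕ) + ∑ j ∈ Finset.Iio i, a j i}

/-- The triangular arrays with exactly `k` zeros on the diagonal. -/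
def triangularArraysWithZeros (n k : ℕ) : Set (Fin n → Fin n → ℕ) :=
  {a | a ∈ triangularArrays n ∧ (Finset.univ.filter fun i => a i i = 0).card = k}

/-!
Both sides of the theorem are governed by `F = iterCT (integrand n)`, regarded as a function of `t`.

*The constant term counts arrays.* Taking the constant terms one after the other, each geometric
series `(x_j - x_i)⁻¹ = ∑ₐ x_i ^ a / x_j ^ (a + 1)` contributes the entry `a_{ij}`, the factor
`t + x_i / (1 - x_i)` contributes the diagonal entry, weighted by `t` if it is `0`, and
`(1 - x_i)⁻¹` is the slack in the row inequality. Hence `F = ∑ₐ t ^ (number of diagonal zeros of a)`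
(`iterCT_integrand_eq_sum`).

*A recurrence in the number `k` of diagonal zeros.* This is Aomoto's argument for the Selberg
integral. The iterated constant term kills every `x_p ∂/∂x_p` (`iterCT_euler_some`). With
`u_i = t (1 - x_i) + x_i`, apply this to the integrand with `u_p` replaced by `1 - x_p` and sum over
`p`. The denominators `x_p - x_j` cancel when the summand for `(p, j)` is added to that for
`(j, p)` (`two_mul_sum_pairs`), because
`(1 - x_p) x_p u_j - (1 - x_j) x_j u_p = (x_p - x_j) (t (1 - x_p) (1 - x_j) - x_p x_j)`.
What remains is a second order differential equation for `F` in `t` (`iterCT_integrand_ode`). If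
`f(n, k)` denotes the number of arrays with `k` diagonal zeros, it says
`(n - k) (n - k + 1) f(n, k) = (k + 1) k f(n, k + 1)` (`arrayCount_rec`), which is the recurrence of
the Narayana numbers; so `f(n, k) = N(n, k) f(n, n)`.

*Normalization.* Moving the last column to the diagonal turns the arrays of size `n + 1` with zero
diagonal into all arrays of size `n` (`arrayCount_succ_self`), so
`f(n + 1, n + 1) = ∑ₖ f(n, k) = f(n, n) ∑ₖ N(n, k)`, and the sum of the Narayana numbers is the
Catalan number (`sum_narayanaNumber`). This gives the product of Catalan numbers by induction.
-/

/-! ### Euler derivations and constant terms -/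

/-- The derivation `f ↦ ∑ₘ (w m cₘ + D cₘ) Xᵐ` of formal Laurent series `f = ∑ₘ cₘ Xᵐ`: the
derivation `D` acts on the coefficients, and `X` is an eigenvector with eigenvalue `w`. Thus `w = 1`,
`D = 0` models `X ∂/∂X`, and `w = 0` models a derivation in another variable. -/
noncomputable def laurentDeriv {K : Type*} [Field K] (w : ℤ) (D : K →+ K) :
    LaurentSeries K →+ LaurentSeries K where
  toFun f :=
    { coeff := fun m => (w * m) • f.coeff m + D (f.coeff m)
      isPWO_support' := f.isPWO_support.mono fun m hm => by
        contrapose! hm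
        simp only [HahnSeries.mem_support, not_not] at hm
        simp [hm] }
  map_zero' := by ext; simp
  map_add' f g := by
    ext m
    simp only [HahnSeries.coeff_add, map_add, smul_add]
    abel

theorem laurentDeriv_coeff {K : Type*} [Field K] (w : ℤ) (D : K →+ K)
    (f : LaurentSeries K) (m : ℤ) :
    (laurentDeriv w D f).coeff m = (w * m) • f.coeff m + D (f.coeff m) := rfl

theorem laurentDeriv_mul {K : Type*} [Field K] (w : ℤ) (D : K →+ K)
    (hD : ∀ a b, D (a * b) = a * D b + b * D a) (f g : LaurentSeries K) :
    laurentDeriv w D (f * g) = f * laurentDeriv w D g + g * laurentDeriv w D f := by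
  have hsupp : ∀ f : LaurentSeries K, (laurentDeriv w D f).support ⊆ f.support := by
    intro f m hm
    contrapose! hm
    simp only [HahnSeries.mem_support, not_not] at hm
    simp [laurentDeriv_coeff, hm]
  ext m
  rw [mul_comm g, HahnSeries.coeff_add, laurentDeriv_coeff,
    HahnSeries.coeff_mul_right' g.isPWO_support (hsupp g),
    HahnSeries.coeff_mul_left' f.isPWO_support (hsupp f), HahnSeries.coeff_mul,
    Finset.smul_sum, map_sum, ← Finset.sum_add_distrib, ← Finset.sum_add_distrib]
  refine Finset.sum_congr rfl fun ij hij => ?_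
  rw [Finset.mem_antidiagonal] at hij
  obtain ⟨-, -, rfl⟩ := hij
  simp only [laurentDeriv_coeff, hD, zsmul_eq_mul]
  push_cast
  ring

namespace RatField

theorem var_ne_zero {σ : Type} (s : σ) : var s ≠ 0 := by
  rw [var, Ne, IsFractionRing.to_map_eq_zero_iff]
  exact MvPolynomial.X_ne_zero s

theorem var_injective {σ : Type} : Function.Injective (var : σ → RatField σ) := fun _ _ h =>
  MvPolynomial.X_injective (IsFractionRing.injective (MvPolynomial σ ℚ) (RatField σ) h)

/-- An additive map that satisfies the Leibniz rule along a field homomorphism is determined by its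
values at the variables. -/
theorem leibniz_eq_zero {σ : Type} {L : Type*} [Field L] (g : RatField σ →+* L)
    (d : RatField σ →+ L) (hd : ∀ a b, d (a * b) = g a * d b + g b * d a)
    (hv : ∀ s, d (var s) = 0) (f : RatField σ) : d f = 0 := by
  have h1 : d 1 = 0 := by simpa using hd 1 1
  have hp : ∀ p : MvPolynomial σ ℚ, d (algebraMap _ _ p) = 0 := by
    intro p
    induction p using MvPolynomial.induction_on with
    | C a =>
      have hz : ∀ z : ℤ, d (z : RatField σ) = 0 := fun z => by
        rw [← zsmul_one, map_zsmul, h1, smul_zero]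
      rw [← MvPolynomial.algebraMap_eq, ← IsScalarTower.algebraMap_apply, eq_ratCast]
      have hden : (a.den : RatField σ) ≠ 0 := by exact_mod_cast a.den_nz
      have h2 := hd (a : RatField σ) (a.den : RatField σ)
      have h3 : (a : RatField σ) * (a.den : RatField σ) = (a.num : ℤ) := by
        exact_mod_cast congrArg (fun q : ℚ => (q : RatField σ)) (Rat.mul_den_eq_num a)
      have h4 := hz (a.den : ℤ)
      rw [Int.cast_natCast] at h4
      rw [h3, hz, h4, mul_zero, zero_add] at h2
      exact (mul_eq_zero.mp h2.symm).resolve_left ((map_ne_zero g).mpr hden)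
    | add p q hp hq => rw [map_add, map_add, hp, hq, add_zero]
    | mul_X p r hp =>
      have := hv r
      rw [var] at this
      rw [map_mul, hd, hp, this, mul_zero, mul_zero, add_zero]
  obtain ⟨a, b, hb, rfl⟩ := IsFractionRing.div_surjective (A := MvPolynomial σ ℚ) f
  have hb0 : algebraMap (MvPolynomial σ ℚ) (RatField σ) b ≠ 0 :=
    IsFractionRing.to_map_ne_zero_of_mem_nonZeroDivisors hb
  have := hd (algebraMap (MvPolynomial σ ℚ) (RatField σ) a / algebraMap _ _ b) (algebraMap _ _ b)
  rw [div_mul_cancel₀ _ hb0, hp, hp, mul_zero, zero_add] at this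
  exact (mul_eq_zero.mp this.symm).resolve_left (by simpa using hb0)

open Classical in
/-- The map `p ↦ p + ε x_s ∂p/∂x_s` from polynomials to dual numbers. -/
noncomputable def polyDual {σ : Type} (s : σ) :
    MvPolynomial σ ℚ →+* DualNumber (RatField σ) :=
  MvPolynomial.eval₂Hom ((TrivSqZeroExt.inlHom (RatField σ) (RatField σ)).comp
    (algebraMap ℚ (RatField σ))) fun r =>
      TrivSqZeroExt.inl (var r) + if r = s then TrivSqZeroExt.inr (var r) else 0

theorem fst_polyDual {σ : Type} (s : σ) (p : MvPolynomial σ ℚ) :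
    (polyDual s p).fst = algebraMap _ (RatField σ) p := by
  induction p using MvPolynomial.induction_on with
  | C a =>
    rw [← MvPolynomial.algebraMap_eq, ← IsScalarTower.algebraMap_apply]
    simp [polyDual, MvPolynomial.algebraMap_eq]
  | add p q hp hq => rw [map_add, map_add, TrivSqZeroExt.fst_add, hp, hq]
  | mul_X p r hp =>
    rw [map_mul, map_mul, TrivSqZeroExt.fst_mul, hp]
    congr 1
    by_cases h : r = s <;> simp [polyDual, h, var]

/-- The map `f ↦ f + ε x_s ∂f/∂x_s` from rational functions to dual numbers. -/
noncomputable def dualHom {σ : Type} (s : σ) : RatField σ →+* DualNumber (RatField σ) :=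
  IsLocalization.lift (M := nonZeroDivisors (MvPolynomial σ ℚ)) (g := polyDual s) fun y => by
    rw [TrivSqZeroExt.isUnit_iff_isUnit_fst, fst_polyDual]
    exact (IsFractionRing.to_map_ne_zero_of_mem_nonZeroDivisors y.2).isUnit

theorem dualHom_algebraMap {σ : Type} (s : σ) (p : MvPolynomial σ ℚ) :
    dualHom s (algebraMap _ _ p) = polyDual s p :=
  IsLocalization.lift_eq _ _

theorem fst_dualHom {σ : Type} (s : σ) (f : RatField σ) : (dualHom s f).fst = f := by
  have : ((TrivSqZeroExt.fstHom (RatField σ) (RatField σ) (RatField σ)).toRingHom.comp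
      (dualHom s)) = RingHom.id _ := by
    refine IsLocalization.ringHom_ext (nonZeroDivisors (MvPolynomial σ ℚ)) ?_
    refine RingHom.ext fun p => ?_
    simp [dualHom_algebraMap, fst_polyDual]
  exact RingHom.congr_fun this f

/-- The Euler derivation `x_s ∂/∂x_s` of the field of rational functions. -/
noncomputable def euler {σ : Type} (s : σ) : RatField σ →+ RatField σ :=
  (TrivSqZeroExt.sndHom (RatField σ) (RatField σ)).toAddMonoidHom.comp
    (dualHom s).toAddMonoidHom

theorem euler_mul {σ : Type} (s : σ) (a b : RatField σ) :
    euler s (a * b) = a * euler s b + b * euler s a := by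
  simp [euler, fst_dualHom, mul_comm]

theorem euler_var_self {σ : Type} (s : σ) : euler s (var s) = var s := by
  have h : dualHom s (var s) = _ := dualHom_algebraMap s (MvPolynomial.X s)
  simp [euler, h, polyDual]

theorem euler_one {σ : Type} (s : σ) : euler s 1 = 0 := by
  simpa using euler_mul s 1 1

theorem euler_var_of_ne {σ : Type} {r s : σ} (h : r ≠ s) : euler s (var r) = 0 := by
  have h' : dualHom s (var r) = _ := dualHom_algebraMap s (MvPolynomial.X r)
  simp [euler, h', polyDual, h]

theorem laurent_algebraMap {σ : Type} (s : σ) (p : MvPolynomial σ ℚ) :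
    laurent s (algebraMap _ _ p) = singleLaurent s p :=
  IsLocalization.lift_eq _ _

theorem laurent_var_self {σ : Type} (s : σ) : laurent s (var s) = HahnSeries.single 1 1 := by
  rw [var, laurent_algebraMap]
  simp [singleLaurent, single]

theorem laurent_var_of_ne {σ : Type} {r s : σ} (h : r ≠ s) :
    laurent s (var r) = HahnSeries.C (var r) := by
  rw [var, laurent_algebraMap]
  simp [singleLaurent, single, h, var]

/-- If `f` does not involve `x_s`, its Laurent expansion in `x_s` is constant, and `f` can be pulled
out of the constant term. -/
theorem CT_mul_left {σ : Type} {s : σ} {c : RatField σ} (hc : laurent s c = HahnSeries.C c)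
    (f : RatField σ) : CT s (c * f) = c * CT s f := by
  rw [CT, CT, map_mul, hc, HahnSeries.C_mul_eq_smul, HahnSeries.coeff_smul, smul_eq_mul]

theorem CT_add {σ : Type} (s : σ) (f g : RatField σ) : CT s (f + g) = CT s f + CT s g := by
  simp [CT]

theorem CT_zero {σ : Type} (s : σ) : CT s 0 = 0 := by
  simp [CT]

theorem CT_sum {σ ι : Type} (s : σ) (A : Finset ι) (f : ι → RatField σ) :
    CT s (∑ a ∈ A, f a) = ∑ a ∈ A, CT s (f a) :=
  map_sum (⟨⟨CT s, CT_zero s⟩, CT_add s⟩ : RatField σ →+ RatField σ) f A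

/-- Laurent expansion intertwines an Euler derivation with a derivation of Laurent series as soon as
it does so at the variables. -/
theorem laurent_eq_of_leibniz {σ : Type} {s r : σ} (w : ℤ)
    (D : RatField σ →+ RatField σ) (hD : ∀ a b, D (a * b) = a * D b + b * D a)
    (h : ∀ q : σ, laurent s (euler r (var q)) = laurentDeriv w D (laurent s (var q)))
    (f : RatField σ) : laurent s (euler r f) = laurentDeriv w D (laurent s f) := by
  have := leibniz_eq_zero (laurent s)
    ((laurent s).toAddMonoidHom.comp (euler r) -
      (laurentDeriv w D).comp (laurent s).toAddMonoidHom) (fun a b => by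
        simp only [AddMonoidHom.sub_apply, AddMonoidHom.comp_apply]
        simp [laurentDeriv_mul w D hD, euler_mul]
        ring) (fun q => by simp [h q]) f
  simpa [sub_eq_zero] using this

/-- The constant term in `x_s` kills the image of `x_s ∂/∂x_s`. -/
theorem CT_euler_self {σ : Type} (s : σ) (f : RatField σ) : CT s (euler s f) = 0 := by
  rw [CT, laurent_eq_of_leibniz 1 0 (by simp) (fun q => ?_), laurentDeriv_coeff]
  · simp
  · by_cases h : q = s
    · subst h
      rw [euler_var_self, laurent_var_self]
      ext m
      rw [laurentDeriv_coeff]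
      by_cases hm : m = 1 <;> simp [hm]
    · rw [euler_var_of_ne h, laurent_var_of_ne h]
      ext m
      rw [laurentDeriv_coeff]
      by_cases hm : m = 0 <;> simp [hm]

theorem CT_euler_of_ne {σ : Type} {s r : σ} (h : s ≠ r) (f : RatField σ) :
    CT s (euler r f) = euler r (CT s f) := by
  rw [CT, laurent_eq_of_leibniz 0 (euler r) (euler_mul r) (fun q => ?_), laurentDeriv_coeff]
  · simp [CT]
  · by_cases hq : q = s
    · subst hq
      rw [euler_var_of_ne h, laurent_var_self]
      ext m
      rw [laurentDeriv_coeff]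
      by_cases hm : m = 1 <;> simp [hm, euler_one]
    · rw [laurent_var_of_ne hq]
      by_cases hr : q = r
      · subst hr
        rw [euler_var_self, laurent_var_of_ne hq]
        ext m
        rw [laurentDeriv_coeff]
        by_cases hm : m = 0 <;> simp [hm, euler_var_self]
      · rw [euler_var_of_ne hr]
        ext m
        rw [laurentDeriv_coeff]
        by_cases hm : m = 0 <;> simp [hm, euler_var_of_ne hr]

theorem foldl_CT_euler_of_notMem {n : ℕ} (l : List (Fin n)) (r : Option (Fin n))
    (hr : ∀ i ∈ l, some i ≠ r) (f : RatField (Option (Fin n))) :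
    l.foldl (fun g i => CT (some i) g) (euler r f) =
      euler r (l.foldl (fun g i => CT (some i) g) f) := by
  induction l generalizing f with
  | nil => rfl
  | cons a l ih =>
    rw [List.foldl_cons, List.foldl_cons, CT_euler_of_ne (hr a (by simp)), ih]
    exact fun i hi => hr i (by simp [hi])

/-- `iterCT` as an additive map. -/
noncomputable def iterCTHom (n : ℕ) :
    RatField (Option (Fin n)) →+ RatField (Option (Fin n)) where
  toFun := iterCT
  map_zero' := by
    unfold iterCT
    generalize List.finRange n = l
    induction l with
    | nil => rfl
    | cons a l ih => rw [List.foldl_cons, CT_zero, ih]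
  map_add' f g := by
    unfold iterCT
    generalize List.finRange n = l
    induction l generalizing f g with
    | nil => rfl
    | cons a l ih => rw [List.foldl_cons, CT_add, ih, List.foldl_cons, List.foldl_cons]

theorem iterCTHom_apply {n : ℕ} (f : RatField (Option (Fin n))) : iterCTHom n f = iterCT f := rfl

theorem iterCT_mul_left {n : ℕ} {c : RatField (Option (Fin n))}
    (hc : ∀ i, laurent (some i) c = HahnSeries.C c) (f : RatField (Option (Fin n))) :
    iterCT (c * f) = c * iterCT f := by
  unfold iterCT
  generalize List.finRange n = l
  induction l generalizing f with
  | nil => rfl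
  | cons a l ih => rw [List.foldl_cons, CT_mul_left (hc a), ih, List.foldl_cons]

theorem iterCT_euler_none {n : ℕ} (f : RatField (Option (Fin n))) :
    iterCT (euler none f) = euler none (iterCT f) :=
  foldl_CT_euler_of_notMem _ _ (by simp) f

/-- The iterated constant term kills the image of every `x_p ∂/∂x_p`: this derivation commutes with
the constant terms taken before the one in `x_p`. -/
theorem iterCT_euler_some {n : ℕ} (p : Fin n) (f : RatField (Option (Fin n))) :
    iterCT (euler (some p) f) = 0 := by
  unfold iterCT
  obtain ⟨l₁, l₂, h⟩ := List.append_of_mem (List.mem_finRange p)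
  have hnd := List.nodup_finRange n
  rw [h, List.nodup_append] at hnd
  rw [h, List.foldl_append, foldl_CT_euler_of_notMem, List.foldl_cons, CT_euler_self]
  · generalize l₂ = l
    induction l with
    | nil => rfl
    | cons a l ih => rw [List.foldl_cons, CT_zero, ih]
  · intro i hi h
    exact hnd.2.2 i hi p (by simp) (Option.some_injective _ h)

end RatField

/-! ### The differential equation in `t` -/

namespace RatField

/-- The logarithmic derivative with respect to `x_s ∂/∂x_s`. -/
noncomputable def logEuler {σ : Type} (s : σ) (f : RatField σ) : RatField σ := euler s f / f

theorem euler_eq_logEuler_mul {σ : Type} (s : σ) {f : RatField σ} (hf : f ≠ 0) :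
    euler s f = logEuler s f * f := (div_mul_cancel₀ _ hf).symm

theorem logEuler_mul {σ : Type} (s : σ) {f g : RatField σ} (hf : f ≠ 0) (hg : g ≠ 0) :
    logEuler s (f * g) = logEuler s f + logEuler s g := by
  rw [logEuler, logEuler, logEuler, euler_mul]
  field_simp
  ring

theorem logEuler_inv {σ : Type} (s : σ) {f : RatField σ} (hf : f ≠ 0) :
    logEuler s f⁻¹ = -logEuler s f := by
  have h := logEuler_mul s hf (inv_ne_zero hf)
  rw [mul_inv_cancel₀ hf] at h
  have h1 : logEuler s (1 : RatField σ) = 0 := by simp [logEuler, euler_one]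
  rw [h1] at h
  linear_combination -h

theorem logEuler_prod {σ ι : Type} (s : σ) (A : Finset ι) (f : ι → RatField σ)
    (hf : ∀ i ∈ A, f i ≠ 0) : logEuler s (∏ i ∈ A, f i) = ∑ i ∈ A, logEuler s (f i) := by
  classical
  induction A using Finset.induction_on with
  | empty => simp [logEuler, euler_one]
  | insert a A ha ih =>
    rw [Finset.prod_insert ha, Finset.sum_insert ha, logEuler_mul s (hf a (by simp)), ih]
    · exact fun i hi => hf i (by simp [hi])
    · exact Finset.prod_ne_zero_iff.mpr fun i hi => hf i (by simp [hi])

variable {n : ℕ}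

theorem one_sub_var_ne_zero {σ : Type} (s : σ) : (1 : RatField σ) - var s ≠ 0 := by
  intro h
  have h1 := congrArg (euler s) h
  rw [map_sub, euler_one, euler_var_self, map_zero, zero_sub, neg_eq_zero] at h1
  exact var_ne_zero s h1

theorem var_sub_var_ne_zero {σ : Type} {r s : σ} (h : r ≠ s) : var r - var s ≠ 0 :=
  sub_ne_zero.mpr (var_injective.ne h)

/-- The linear form `t (1 - x_i) + x_i` in `t`. -/
noncomputable def linForm (i : Fin n) : RatField (Option (Fin n)) :=
  var none * (1 - var (some i)) + var (some i)

theorem euler_none_linForm (i : Fin n) :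
    euler none (linForm i) = var none * (1 - var (some i)) := by
  rw [linForm, map_add, euler_mul, map_sub, euler_one, euler_var_of_ne (by simp : some i ≠ none),
    euler_var_self]
  ring

theorem linForm_ne_zero (i : Fin n) : linForm i ≠ 0 := by
  intro h
  have h1 := congrArg (euler none) h
  rw [euler_none_linForm, map_zero] at h1
  exact mul_ne_zero (var_ne_zero _) (one_sub_var_ne_zero _) h1

theorem euler_some_linForm_of_ne {p i : Fin n} (h : i ≠ p) : euler (some p) (linForm i) = 0 := by
  rw [linForm, map_add, euler_mul, map_sub, euler_one, euler_var_of_ne (by simpa using h),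
    euler_var_of_ne (by simp)]
  ring

/-- The factor `∏_{i < j} (x_j - x_i)⁻¹` of the integrand. -/
noncomputable def invVandermonde (n : ℕ) : RatField (Option (Fin n)) :=
  ∏ j : Fin n, ∏ i ∈ Finset.Iio j, (var (some j) - var (some i))⁻¹

/-- The factor of the integrand that does not involve `t`. -/
noncomputable def kernel (n : ℕ) : RatField (Option (Fin n)) :=
  (∏ i : Fin n, (1 - var (some i))⁻¹ * (1 - var (some i))⁻¹) * invVandermonde n

theorem integrand_eq (n : ℕ) : integrand n = (∏ i : Fin n, linForm i) * kernel n := by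
  rw [kernel, ← mul_assoc, ← Finset.prod_mul_distrib]
  refine congrArg (· * invVandermonde n) (Finset.prod_congr rfl fun i _ => ?_)
  have := one_sub_var_ne_zero (some i)
  rw [linForm]
  field_simp

theorem invVandermonde_ne_zero : invVandermonde n ≠ 0 :=
  Finset.prod_ne_zero_iff.mpr fun _ _ => Finset.prod_ne_zero_iff.mpr fun _ hi =>
    inv_ne_zero (var_sub_var_ne_zero (by simpa using (Finset.mem_Iio.mp hi).ne'))

theorem kernel_ne_zero : kernel n ≠ 0 :=
  mul_ne_zero (Finset.prod_ne_zero_iff.mpr fun _ _ => mul_ne_zero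
    (inv_ne_zero (one_sub_var_ne_zero _)) (inv_ne_zero (one_sub_var_ne_zero _)))
    invVandermonde_ne_zero

theorem integrand_ne_zero : integrand n ≠ 0 := by
  rw [integrand_eq]
  exact mul_ne_zero (Finset.prod_ne_zero_iff.mpr fun _ _ => linForm_ne_zero _) kernel_ne_zero

theorem logEuler_invVandermonde (p : Fin n) :
    logEuler (some p) (invVandermonde n) =
      -∑ j ∈ Finset.univ.erase p, var (some p) / (var (some p) - var (some j)) := by
  have hne : ∀ j : Fin n, ∀ i ∈ Finset.Iio j, (var (some j) - var (some i)) ≠ 0 := fun j i hi =>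
    var_sub_var_ne_zero (by simpa using (Finset.mem_Iio.mp hi).ne')
  have key : ∀ j : Fin n, ∀ i ∈ Finset.Iio j,
      logEuler (some p) (var (some j) - var (some i))⁻¹ =
        (if j = p then -(var (some p) / (var (some p) - var (some i))) else 0) +
        (if i = p then -(var (some p) / (var (some p) - var (some j))) else 0) := by
    intro j i hi
    have hij := (Finset.mem_Iio.mp hi).ne
    rw [logEuler_inv _ (hne j i hi), logEuler, map_sub]
    by_cases hj : j = p
    · subst hj
      rw [if_pos rfl, if_neg hij, euler_var_self, euler_var_of_ne (by simpa using hij)]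
      ring
    · by_cases hi' : i = p
      · subst hi'
        rw [if_neg hj, if_pos rfl, euler_var_self, euler_var_of_ne (by simpa using hj),
          ← neg_sub (var (some j)), div_neg]
        ring
      · rw [if_neg hj, if_neg hi', euler_var_of_ne (by simpa using hj),
          euler_var_of_ne (by simpa using hi')]
        simp
  rw [invVandermonde, logEuler_prod _ _ _ fun j _ => Finset.prod_ne_zero_iff.mpr fun i hi =>
    inv_ne_zero (hne j i hi)]
  rw [Finset.sum_congr rfl fun j _ => by
    rw [logEuler_prod _ _ _ fun i hi => inv_ne_zero (hne j i hi), Finset.sum_congr rfl (key j),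
      Finset.sum_add_distrib]]
  have hsplit : (Finset.univ.erase p : Finset (Fin n)) = Finset.Iio p ∪ Finset.Ioi p := by
    ext j
    simp
  rw [Finset.sum_add_distrib, hsplit, Finset.sum_union (by
    rw [Finset.disjoint_left]
    intro a ha hb
    simp only [Finset.mem_Iio, Finset.mem_Ioi] at ha hb
    exact lt_asymm ha hb), neg_add]
  congr 1
  · rw [Finset.sum_eq_single p (fun j _ hj => by simp [hj]) (by simp)]
    simp
  · simp only [Finset.sum_ite_eq', Finset.mem_Iio]
    rw [← Finset.sum_filter, ← Finset.sum_neg_distrib]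
    refine Finset.sum_congr ?_ fun _ _ => rfl
    ext j
    simp

theorem logEuler_kernel (p : Fin n) :
    logEuler (some p) (kernel n) = 2 * (var (some p) / (1 - var (some p))) -
      ∑ j ∈ Finset.univ.erase p, var (some p) / (var (some p) - var (some j)) := by
  have h1 : ∀ i : Fin n, (1 : RatField (Option (Fin n))) - var (some i) ≠ 0 :=
    fun i => one_sub_var_ne_zero _
  rw [kernel, logEuler_mul _ (Finset.prod_ne_zero_iff.mpr fun i _ => mul_ne_zero
    (inv_ne_zero (h1 i)) (inv_ne_zero (h1 i))) invVandermonde_ne_zero, logEuler_invVandermonde,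
    logEuler_prod _ _ _ fun i _ => mul_ne_zero (inv_ne_zero (h1 i)) (inv_ne_zero (h1 i)),
    ← sub_eq_add_neg]
  congr 1
  rw [Finset.sum_eq_single p (fun i _ hi => ?_) (by simp)]
  · rw [logEuler_mul _ (inv_ne_zero (h1 p)) (inv_ne_zero (h1 p)), logEuler_inv _ (h1 p), logEuler,
      map_sub, euler_one, euler_var_self]
    ring
  · rw [logEuler_mul _ (inv_ne_zero (h1 i)) (inv_ne_zero (h1 i)), logEuler_inv _ (h1 i), logEuler,
      map_sub, euler_one, euler_var_of_ne (by simpa using hi)]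
    simp

/-- The derivative in `x_p` of the integrand with its factor `t (1 - x_p) + x_p` replaced
by `1 - x_p`. -/
theorem euler_some_integrand (p : Fin n) :
    euler (some p) ((1 - var (some p)) / linForm p * integrand n) =
      (var (some p) / linForm p - ∑ j ∈ Finset.univ.erase p,
        (1 - var (some p)) * var (some p) / linForm p / (var (some p) - var (some j))) *
          integrand n := by
  have h1 := one_sub_var_ne_zero (some p)
  have hu := linForm_ne_zero p
  have hprod : ∏ i ∈ Finset.univ.erase p, linForm i ≠ 0 :=
    Finset.prod_ne_zero_iff.mpr fun i _ => linForm_ne_zero i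
  have e1 : (1 - var (some p)) / linForm p * integrand n =
      (1 - var (some p)) * ((∏ i ∈ Finset.univ.erase p, linForm i) * kernel n) := by
    rw [integrand_eq, ← Finset.mul_prod_erase _ _ (Finset.mem_univ p)]
    field_simp
  have e2 : logEuler (some p) (∏ i ∈ Finset.univ.erase p, linForm i) = 0 := by
    rw [logEuler_prod _ _ _ fun i _ => linForm_ne_zero i]
    refine Finset.sum_eq_zero fun i hi => ?_
    rw [logEuler, euler_some_linForm_of_ne (Finset.ne_of_mem_erase hi), zero_div]
  rw [euler_eq_logEuler_mul _ (mul_ne_zero (div_ne_zero h1 hu) integrand_ne_zero)]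
  nth_rw 1 [e1]
  rw [logEuler_mul _ h1 (mul_ne_zero hprod kernel_ne_zero), logEuler_mul _ hprod kernel_ne_zero,
    e2, logEuler_kernel, logEuler, map_sub, euler_one, euler_var_self]
  have e3 : ∑ j ∈ Finset.univ.erase p,
      (1 - var (some p)) * var (some p) / linForm p / (var (some p) - var (some j)) =
      (1 - var (some p)) / linForm p *
        ∑ j ∈ Finset.univ.erase p, var (some p) / (var (some p) - var (some j)) := by
    rw [Finset.mul_sum]
    exact Finset.sum_congr rfl fun j _ => by ring
  rw [e3]
  field_simp
  ring

/-- The logarithmic derivative `t (1 - x_p) / (t (1 - x_p) + x_p)` of a linear form in `t`. -/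
noncomputable def linLog (p : Fin n) : RatField (Option (Fin n)) :=
  var none * (1 - var (some p)) / linForm p

theorem euler_none_kernel : euler none (kernel n) = 0 := by
  have h1 : ∀ i : Fin n, (1 : RatField (Option (Fin n))) - var (some i) ≠ 0 :=
    fun i => one_sub_var_ne_zero _
  have h2 : ∀ i : Fin n, logEuler none (1 - var (some i)) = 0 := fun i => by
    rw [logEuler, map_sub, euler_one, euler_var_of_ne (by simp)]
    simp
  have hne : ∀ j : Fin n, ∀ i ∈ Finset.Iio j, (var (some j) - var (some i)) ≠ 0 := fun j i hi =>
    var_sub_var_ne_zero (by simpa using (Finset.mem_Iio.mp hi).ne')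
  rw [euler_eq_logEuler_mul _ kernel_ne_zero]
  nth_rw 1 [kernel]
  rw [logEuler_mul _ (Finset.prod_ne_zero_iff.mpr fun i _ => mul_ne_zero
    (inv_ne_zero (h1 i)) (inv_ne_zero (h1 i))) invVandermonde_ne_zero,
    logEuler_prod _ _ _ fun i _ => mul_ne_zero (inv_ne_zero (h1 i)) (inv_ne_zero (h1 i)),
    invVandermonde, logEuler_prod _ _ _ fun j _ => Finset.prod_ne_zero_iff.mpr fun i hi =>
    inv_ne_zero (hne j i hi), Finset.sum_eq_zero, Finset.sum_eq_zero]
  · simp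
  · intro j _
    rw [logEuler_prod _ _ _ fun i hi => inv_ne_zero (hne j i hi)]
    refine Finset.sum_eq_zero fun i hi => ?_
    rw [logEuler_inv _ (hne j i hi), logEuler, map_sub, euler_var_of_ne (by simp),
      euler_var_of_ne (by simp)]
    simp
  · intro i _
    rw [logEuler_mul _ (inv_ne_zero (h1 i)) (inv_ne_zero (h1 i)), logEuler_inv _ (h1 i), h2]
    simp

theorem euler_none_integrand :
    euler none (integrand n) = (∑ p, linLog p) * integrand n := by
  have hprod : ∏ i : Fin n, linForm i ≠ 0 :=
    Finset.prod_ne_zero_iff.mpr fun i _ => linForm_ne_zero i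
  rw [integrand_eq, euler_mul, euler_none_kernel, euler_eq_logEuler_mul _ hprod,
    logEuler_prod _ _ _ fun i _ => linForm_ne_zero i,
    Finset.sum_congr rfl fun p _ => show logEuler none (linForm p) = linLog p by
      rw [logEuler, euler_none_linForm, linLog]]
  ring

theorem euler_none_linLog (p : Fin n) : euler none (linLog p) = linLog p - linLog p ^ 2 := by
  have hu := linForm_ne_zero p
  have h := congrArg (euler none) (show linLog p * linForm p = var none * (1 - var (some p)) from
    div_mul_cancel₀ _ hu)
  rw [euler_mul, euler_none_linForm, euler_mul, map_sub, euler_one, euler_var_of_ne (by simp),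
    euler_var_self] at h
  have h2 : var none * (1 - var (some p)) = linLog p * linForm p := (div_mul_cancel₀ _ hu).symm
  have h3 : linForm p * (euler none (linLog p) - (linLog p - linLog p ^ 2)) = 0 := by
    linear_combination h + (1 - linLog p) * h2
  simpa [hu, sub_eq_zero] using h3

theorem euler_none_euler_none_integrand :
    euler none (euler none (integrand n)) =
      ((∑ p, linLog p) ^ 2 + ∑ p, linLog p - ∑ p, linLog p ^ 2) * integrand n := by
  rw [euler_none_integrand, euler_mul, euler_none_integrand, map_sum,
    Finset.sum_congr rfl fun p _ => euler_none_linLog p, Finset.sum_sub_distrib]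
  ring

theorem sum_erase_mul (f : Fin n → RatField (Option (Fin n))) :
    ∑ p, ∑ j ∈ Finset.univ.erase p, f p * f j = (∑ p, f p) ^ 2 - ∑ p, f p ^ 2 := by
  rw [sq, Finset.sum_mul_sum, ← Finset.sum_sub_distrib]
  refine Finset.sum_congr rfl fun p _ => ?_
  rw [← Finset.add_sum_erase _ _ (Finset.mem_univ p)]
  ring

/-- Exchanging the two indices cancels the denominators `x_p - x_j`. -/
theorem two_mul_sum_pairs :
    2 * (var none * ∑ p : Fin n, ∑ j ∈ Finset.univ.erase p,
      (1 - var (some p)) * var (some p) / linForm p / (var (some p) - var (some j))) =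
      ((∑ p : Fin n, linLog p) ^ 2 - ∑ p : Fin n, linLog p ^ 2) - var none *
        ((∑ p : Fin n, (1 - linLog p)) ^ 2 - ∑ p : Fin n, (1 - linLog p) ^ 2) := by
  have hswap : ∀ f : Fin n → Fin n → RatField (Option (Fin n)),
      ∑ p, ∑ j ∈ Finset.univ.erase p, f p j = ∑ p, ∑ j ∈ Finset.univ.erase p, f j p := fun f =>
    Finset.sum_comm' (by simp [eq_comm, and_comm])
  rw [← sum_erase_mul, ← sum_erase_mul, Finset.mul_sum, two_mul]
  nth_rw 2 [Finset.sum_congr rfl fun p _ => Finset.mul_sum _ _ _]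
  rw [Finset.sum_congr rfl fun p _ => Finset.mul_sum _ _ _]
  nth_rw 2 [hswap]
  rw [Finset.mul_sum, ← Finset.sum_add_distrib, ← Finset.sum_sub_distrib]
  refine Finset.sum_congr rfl fun p _ => ?_
  rw [Finset.mul_sum, ← Finset.sum_add_distrib, ← Finset.sum_sub_distrib]
  refine Finset.sum_congr rfl fun j hj => ?_
  have hjp := Finset.ne_of_mem_erase hj
  have h1 : var (some p) - var (some j) ≠ 0 := var_sub_var_ne_zero (by simpa using hjp.symm)
  have hup := linForm_ne_zero p
  have huj := linForm_ne_zero j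
  have hx : ∀ i : Fin n, 1 - linLog i = var (some i) / linForm i := fun i => by
    have := linForm_ne_zero i
    rw [linLog, eq_div_iff this, sub_mul, div_mul_cancel₀ _ this, linForm]
    ring
  rw [hx, hx, linLog, linLog, ← neg_sub (var (some p)) (var (some j))]
  rw [div_neg]
  field_simp
  rw [linForm, linForm]
  ring

/-- The Euler-operator form of the differential equation in `t` satisfied by the iterated constant
term of the integrand: the sum over `p` of the identities `iterCT_euler_some`, multiplied by `2 t`. -/
theorem iterCT_integrand_ode (n : ℕ) (F : RatField (Option (Fin n)))
    (hF : F = iterCT (integrand n)) :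
    var none * (((n : RatField (Option (Fin n))) ^ 2 + (n : RatField (Option (Fin n)))) * F -
      2 * (n : RatField (Option (Fin n))) * euler none F +
      (euler none (euler none F) - euler none F)) = euler none (euler none F) - euler none F := by
  have ht : ∀ i : Fin n, laurent (some i) (var none) = HahnSeries.C (var none) := fun i =>
    laurent_var_of_ne (by simp)
  have hnat : ∀ m : ℕ, ∀ i : Fin n,
      laurent (some i) (m : RatField (Option (Fin n))) = HahnSeries.C (m : RatField _) :=
    fun m i => by simp
  have key : 2 * (var none * ∑ p : Fin n,
      euler (some p) ((1 - var (some p)) / linForm p * integrand n)) =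
      var none * (((n : RatField (Option (Fin n))) ^ 2 + (n : RatField (Option (Fin n)))) *
        integrand n - 2 * (n : RatField (Option (Fin n))) * euler none (integrand n) +
          (euler none (euler none (integrand n)) -
          euler none (integrand n))) -
        (euler none (euler none (integrand n)) - euler none (integrand n)) := by
    have hsum : ∑ p : Fin n, (1 - linLog p) = n - ∑ p : Fin n, linLog p := by
      simp
    have hsq : ∑ p : Fin n, (1 - linLog p) ^ 2 =
        n - 2 * ∑ p : Fin n, linLog p + ∑ p : Fin n, linLog p ^ 2 := by
      simp only [sub_sq, Finset.sum_add_distrib, Finset.sum_sub_distrib, Finset.mul_sum]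
      simp
    have hx : ∑ p : Fin n, var (some p) / linForm p = ∑ p : Fin n, (1 - linLog p) :=
      Finset.sum_congr rfl fun i _ => by
        have := linForm_ne_zero i
        rw [linLog, div_eq_iff this, sub_mul, div_mul_cancel₀ _ this, linForm]
        ring
    rw [Finset.sum_congr rfl fun p _ => euler_some_integrand p, ← Finset.sum_mul,
      Finset.sum_sub_distrib, hx, hsum, euler_none_euler_none_integrand, euler_none_integrand]
    have := two_mul_sum_pairs (n := n)
    rw [hsum, hsq] at this
    linear_combination (-integrand n) * this
  have h2 : iterCT (2 * (var none * ∑ p : Fin n,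
      euler (some p) ((1 - var (some p)) / linForm p * integrand n))) = 0 := by
    rw [iterCT_mul_left (by simpa using hnat 2), iterCT_mul_left ht, ← iterCTHom_apply, map_sum,
      Finset.sum_eq_zero fun p _ => (iterCTHom_apply _).trans (iterCT_euler_some p _)]
    simp
  rw [key] at h2
  have hc1 := hnat (n ^ 2 + n)
  have hc2 := hnat (2 * n)
  push_cast at hc1 hc2
  rw [← iterCTHom_apply, map_sub, map_sub, iterCTHom_apply, iterCT_mul_left ht, ← iterCTHom_apply,
    map_add, map_sub, map_sub] at h2
  simp only [iterCTHom_apply, iterCT_euler_none] at h2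
  rw [iterCT_mul_left (by simpa using hc1), iterCT_mul_left (by simpa using hc2),
    iterCT_euler_none, ← hF, sub_eq_zero] at h2
  exact h2

end RatField

/-! ### Expansion of the iterated constant term over arrays -/

namespace RatField

/-- The rational functions that do not involve `x_s`, detected by their Laurent expansion. -/
noncomputable def constField {σ : Type} (s : σ) : Subfield (RatField σ) :=
  (laurent s).eqLocusField HahnSeries.C

theorem mem_constField {σ : Type} {s : σ} {f : RatField σ} :
    f ∈ constField s ↔ laurent s f = HahnSeries.C f := Iff.rfl

theorem var_mem_constField {σ : Type} {r s : σ} (h : r ≠ s) : var r ∈ constField s :=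
  laurent_var_of_ne h

/-- The embedding of power series into Laurent series. -/
noncomputable abbrev ofPS (K : Type*) [Field K] : PowerSeries K →+* LaurentSeries K :=
  HahnSeries.ofPowerSeries ℤ K

theorem laurent_var_eq_ofPS {σ : Type} (s : σ) :
    laurent s (var s) = ofPS (RatField σ) PowerSeries.X := by
  rw [laurent_var_self, HahnSeries.ofPowerSeries_X]

theorem laurent_inv_one_sub_var {σ : Type} (s : σ) :
    laurent s (1 - var s)⁻¹ = ofPS (RatField σ) (PowerSeries.mk 1) := by
  rw [map_inv₀, map_sub, map_one, laurent_var_eq_ofPS]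
  refine inv_eq_of_mul_eq_one_left ?_
  rw [← map_one (ofPS (RatField σ)), ← map_sub, ← map_mul,
    PowerSeries.mk_one_mul_one_sub_eq_one, map_one]

theorem laurent_diagonal_factor {σ : Type} {s : σ} {τ : RatField σ} (hτ : τ ∈ constField s) :
    laurent s (τ + var s / (1 - var s)) =
      ofPS (RatField σ) (PowerSeries.mk fun m => if m = 0 then τ else 1) := by
  have h := one_sub_var_ne_zero s
  have e : τ + var s / (1 - var s) = (τ - 1) + (1 - var s)⁻¹ := by
    field_simp
    ring
  rw [e, map_add, laurent_inv_one_sub_var, mem_constField.mp (sub_mem hτ (one_mem _)),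
    ← HahnSeries.ofPowerSeries_C, ← map_add]
  congr 1
  ext m
  by_cases hm : m = 0 <;> simp [hm, PowerSeries.coeff_C]

theorem laurent_inv_var_sub {σ : Type} {r s : σ} (h : r ≠ s) :
    laurent s (var r - var s)⁻¹ =
      ofPS (RatField σ) (PowerSeries.mk fun m => (var r)⁻¹ ^ (1 + m)) := by
  have hr := var_ne_zero r
  rw [map_inv₀, map_sub, laurent_var_of_ne h, laurent_var_eq_ofPS, ← HahnSeries.ofPowerSeries_C,
    ← map_sub]
  refine inv_eq_of_mul_eq_one_right ?_
  rw [← map_mul, ← map_one (ofPS (RatField σ))]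
  congr 1
  ext m
  rw [sub_mul, map_sub, PowerSeries.coeff_C_mul, PowerSeries.coeff_mk]
  cases m with
  | zero => simp [hr]
  | succ m =>
    rw [PowerSeries.coeff_succ_X_mul, PowerSeries.coeff_mk, PowerSeries.coeff_one,
      if_neg (by simp), add_comm 1 (m + 1), pow_succ, mul_comm _ (var r)⁻¹, ← mul_assoc,
      mul_inv_cancel₀ hr, one_mul, add_comm 1 m, sub_self]

/-- The possible rows `(b_j)_{j ≥ p}` of an array whose sum is at most `c`. -/
def rows {n : ℕ} (p : Fin n) (c : ℕ) : Finset (Fin n → ℕ) :=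
  (Finset.range (c + 1)).biUnion fun d => (Finset.Ici p).piAntidiag d

theorem mem_rows {n : ℕ} {p : Fin n} {c : ℕ} {b : Fin n → ℕ} :
    b ∈ rows p c ↔ ∑ j ∈ Finset.Ici p, b j ≤ c ∧ ∀ j, j < p → b j = 0 := by
  simp only [rows, Finset.mem_biUnion, Finset.mem_range, Finset.mem_piAntidiag, Finset.mem_Ici]
  constructor
  · rintro ⟨d, hd, hs, h⟩
    exact ⟨hs.trans_le (by omega), fun j hj => by_contra fun h0 => absurd (h j h0) (not_le.mpr hj)⟩
  · rintro ⟨h1, h2⟩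
    exact ⟨_, Nat.lt_succ_of_le h1, rfl, fun j hj => not_lt.mp fun h => hj (h2 j h)⟩

/-- The weight of a diagonal entry: `t` for a zero entry and `1` for a positive one. -/
noncomputable def diagWeight (n a : ℕ) : RatField (Option (Fin n)) :=
  if a = 0 then var none else 1

theorem coeff_mk_one_mul {R : Type*} [CommRing R] (c : ℕ) (f : PowerSeries R) :
    PowerSeries.coeff c (PowerSeries.mk 1 * f) =
      ∑ d ∈ Finset.range (c + 1), PowerSeries.coeff d f := by
  rw [mul_comm, PowerSeries.coeff_mul, Finset.Nat.sum_antidiagonal_eq_sum_range_succ_mk]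
  simp

theorem coeff_prod_piAntidiag {R ι : Type*} [CommRing R] [DecidableEq ι]
    (f : ι → PowerSeries R) (d : ℕ) (s : Finset ι) :
    PowerSeries.coeff d (∏ j ∈ s, f j) =
      ∑ b ∈ s.piAntidiag d, ∏ j ∈ s, PowerSeries.coeff (b j) (f j) := by
  rw [PowerSeries.coeff_prod]
  refine Finset.sum_bij (fun l _ => l) (fun l hl => ?_) (fun l _ l' _ h => DFunLike.coe_injective h)
    (fun b hb => ?_) fun _ _ => rfl
  · rw [Finset.mem_finsuppAntidiag] at hl
    rw [Finset.mem_piAntidiag]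
    exact ⟨hl.1, fun i hi => hl.2 (Finsupp.mem_support_iff.mpr hi)⟩
  · rw [Finset.mem_piAntidiag] at hb
    refine ⟨Finsupp.onFinset s b hb.2, ?_, rfl⟩
    rw [Finset.mem_finsuppAntidiag]
    exact ⟨hb.1, Finsupp.support_onFinset_subset⟩

/-- The constant term in `x_p` of the part of the integrand that involves `x_p`, after the
constant terms in the preceding variables have left a factor `x_p ^ (-c)`. -/
theorem CT_row {n : ℕ} (p : Fin n) (c : ℕ) :
    CT (some p) ((var (some p))⁻¹ ^ c *
      ((1 - var (some p))⁻¹ * (var none + var (some p) / (1 - var (some p)))) *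
        ∏ j ∈ Finset.Ioi p, (var (some j) - var (some p))⁻¹) =
      ∑ b ∈ rows p c, diagWeight n (b p) *
        ∏ j ∈ Finset.Ioi p, (var (some j))⁻¹ ^ (1 + b j) := by
  have hIci : Finset.Ici p = insert p (Finset.Ioi p) := (Finset.Ioi_insert p).symm
  have hprod : laurent (some p) (∏ j ∈ Finset.Ioi p, (var (some j) - var (some p))⁻¹) =
      ofPS _ (∏ j ∈ Finset.Ioi p, PowerSeries.mk fun m => (var (some j))⁻¹ ^ (1 + m)) := by
    rw [map_prod, map_prod]
    exact Finset.prod_congr rfl fun j hj =>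
      laurent_inv_var_sub (by simpa using (Finset.mem_Ioi.mp hj).ne')
  have hpow : laurent (some p) ((var (some p))⁻¹ ^ c) = HahnSeries.single (-(c : ℤ)) 1 := by
    rw [map_pow, map_inv₀, laurent_var_self, inv_pow]
    refine inv_eq_of_mul_eq_one_right ?_
    rw [HahnSeries.single_pow, HahnSeries.single_mul_single]
    simp
  rw [CT, map_mul, map_mul, map_mul, hpow, laurent_inv_one_sub_var,
    laurent_diagonal_factor (var_mem_constField (by simp)), hprod, mul_assoc, ← map_mul, ← map_mul,
    HahnSeries.coeff_single_mul, one_mul, zero_sub, neg_neg, HahnSeries.ofPowerSeries_apply_coeff,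
    mul_assoc, coeff_mk_one_mul]
  have hIoi : p ∉ Finset.Ioi p := by simp
  have hfun : (PowerSeries.mk fun m => if m = 0 then var none else 1) *
      ∏ j ∈ Finset.Ioi p, (PowerSeries.mk fun m => (var (some j))⁻¹ ^ (1 + m)) =
      ∏ j ∈ Finset.Ici p, PowerSeries.mk fun m =>
        if j = p then diagWeight n m else (var (some j))⁻¹ ^ (1 + m) := by
    rw [hIci, Finset.prod_insert hIoi]
    congr 1
    · simp [diagWeight]
    · refine Finset.prod_congr rfl fun j hj => ?_
      simp [(Finset.mem_Ioi.mp hj).ne']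
  rw [hfun, rows, Finset.sum_biUnion]
  · refine Finset.sum_congr rfl fun d _ => ?_
    rw [coeff_prod_piAntidiag]
    refine Finset.sum_congr rfl fun b _ => ?_
    rw [hIci, Finset.prod_insert hIoi]
    congr 1
    · simp
    · refine Finset.prod_congr rfl fun j hj => ?_
      simp [(Finset.mem_Ioi.mp hj).ne']
  · intro d _ d' _ hdd
    rw [Function.onFun, Finset.disjoint_left]
    intro b hb hb'
    exact hdd ((Finset.mem_piAntidiag.mp hb).1.symm.trans (Finset.mem_piAntidiag.mp hb').1)

/-- The arrays whose first `m` rows satisfy the row inequalities and whose other rows vanish, built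
row by row. For `m ≥ n` these are all triangular arrays. -/
def partialArrays (n : ℕ) : ℕ → Finset (Fin n → Fin n → ℕ)
  | 0 => {0}
  | m + 1 =>
    if h : m < n then
      (partialArrays n m).biUnion fun a =>
        (rows ⟨m, h⟩ (m + ∑ i ∈ Finset.Iio ⟨m, h⟩, a i ⟨m, h⟩)).image (Function.update a ⟨m, h⟩)
    else partialArrays n m

theorem mem_partialArrays {n : ℕ} (m : ℕ) (a : Fin n → Fin n → ℕ) :
    a ∈ partialArrays n m ↔ (∀ i j : Fin n, (j < i ∨ m ≤ i.val) → a i j = 0) ∧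
      ∀ i : Fin n, (i : ℕ) < m → ∑ j ∈ Finset.Ici i, a i j ≤ (i : ℕ) + ∑ j ∈ Finset.Iio i, a j i := by
  induction m generalizing a with
  | zero =>
    rw [partialArrays, Finset.mem_singleton]
    constructor
    · rintro rfl
      simp
    · rintro ⟨h, -⟩
      funext i j
      exact h i j (Or.inr (Nat.zero_le _))
  | succ m ih =>
    rw [partialArrays]
    split_ifs with hm
    · set p : Fin n := ⟨m, hm⟩ with hp
      have hpv : (p : ℕ) = m := rfl
      simp only [Finset.mem_biUnion, Finset.mem_image, ih, mem_rows]
      constructor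
      · rintro ⟨a', ⟨h1, h2⟩, b, ⟨h3, h4⟩, rfl⟩
        have hlt : ∀ i : Fin n, i < p → Function.update a' p b i = a' i := fun i hi =>
          Function.update_of_ne hi.ne _ _
        refine ⟨fun i j hij => ?_, fun i hi => ?_⟩
        · by_cases hi : i = p
          · subst hi
            rw [Function.update_self]
            exact h4 j (hij.resolve_right (by omega))
          · rw [Function.update_of_ne hi]
            exact h1 i j (hij.imp_right fun h => by omega)
        · have hle : i ≤ p := Fin.le_def.mpr (by omega)
          have hs : ∑ j ∈ Finset.Iio i, Function.update a' p b j i = ∑ j ∈ Finset.Iio i, a' j i :=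
            Finset.sum_congr rfl fun j hj => by
              rw [hlt j (lt_of_lt_of_le (Finset.mem_Iio.mp hj) hle)]
          rw [hs]
          rcases hle.lt_or_eq with hi' | rfl
          · rw [hlt i hi']
            exact h2 i (Fin.lt_def.mp hi')
          · rw [Function.update_self]
            exact h3
      · rintro ⟨h1, h2⟩
        have hlt : ∀ i : Fin n, i < p → Function.update a p 0 i = a i := fun i hi =>
          Function.update_of_ne hi.ne _ _
        have hs : ∀ i ≤ p, ∑ j ∈ Finset.Iio i, Function.update a p 0 j i =
            ∑ j ∈ Finset.Iio i, a j i := fun i hi =>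
          Finset.sum_congr rfl fun j hj => by
            rw [hlt j (lt_of_lt_of_le (Finset.mem_Iio.mp hj) hi)]
        refine ⟨Function.update a p 0, ⟨fun i j hij => ?_, fun i hi => ?_⟩, a p, ⟨?_, ?_⟩, ?_⟩
        · by_cases hi : i = p
          · subst hi
            simp
          · rw [Function.update_of_ne hi]
            have : (i : ℕ) ≠ m := fun h => hi (Fin.ext h)
            exact h1 i j (hij.imp_right fun h => by omega)
        · have hi' : i < p := Fin.lt_def.mpr hi
          rw [hlt i hi', hs i hi'.le]
          exact h2 i (by omega)
        · rw [hs p le_rfl]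
          exact h2 p (by omega)
        · exact fun j hj => h1 p j (Or.inl hj)
        · simp
    · rw [ih]
      refine and_congr (forall₂_congr fun i j => ?_) (forall_congr' fun i => ?_)
      · have := i.2
        exact imp_congr_left (or_congr_right (by omega))
      · have := i.2
        exact imp_congr_left (by omega)

/-- The factor at `x_j` of the function left after `m` constant terms. -/
noncomputable def remainingFactor {n : ℕ} (m : ℕ) (a : Fin n → Fin n → ℕ) (j : Fin n) :
    RatField (Option (Fin n)) :=
  (var (some j))⁻¹ ^ (m + ∑ i : Fin n with i.val < m, a i j) *
    ((1 - var (some j))⁻¹ * (var none + var (some j) / (1 - var (some j)))) *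
      ∏ k ∈ Finset.Ioi j, (var (some k) - var (some j))⁻¹

theorem remainingFactor_mem_constField {n : ℕ} {p j : Fin n} (m : ℕ) (a : Fin n → Fin n → ℕ)
    (h : p < j) : remainingFactor m a j ∈ constField (some p) := by
  have hv : ∀ k, p < k → var (some k) ∈ constField (some p) := fun k hk =>
    var_mem_constField (by simpa using hk.ne')
  have h1 := sub_mem (one_mem (constField (some p))) (hv j h)
  exact mul_mem (mul_mem (pow_mem (inv_mem (hv j h)) _) (mul_mem (inv_mem h1)
    (add_mem (var_mem_constField (by simp)) (div_mem (hv j h) h1)))) (prod_mem fun k hk =>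
      inv_mem (sub_mem (hv k (h.trans (Finset.mem_Ioi.mp hk))) (hv j h)))

/-- The function left after the constant terms in the first `m` variables. -/
noncomputable def partialCT (n m : ℕ) : RatField (Option (Fin n)) :=
  ∑ a ∈ partialArrays n m, (∏ i : Fin n with i.val < m, diagWeight n (a i i)) *
    ∏ j : Fin n with m ≤ j.val, remainingFactor m a j

theorem partialCT_zero (n : ℕ) : partialCT n 0 = integrand n := by
  have hV : (∏ j : Fin n, ∏ i ∈ Finset.Iio j, (var (some j) - var (some i))⁻¹ :
      RatField (Option (Fin n))) = ∏ i, ∏ j ∈ Finset.Ioi i, (var (some j) - var (some i))⁻¹ :=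
    Finset.prod_comm' (by simp)
  rw [partialCT, partialArrays, Finset.sum_singleton, integrand, hV, ← Finset.prod_mul_distrib]
  simp [remainingFactor]

theorem diagWeight_mem_constField {n : ℕ} (p : Fin n) (a : ℕ) :
    diagWeight n a ∈ constField (some p) := by
  rw [diagWeight]
  split_ifs
  exacts [var_mem_constField (by simp), one_mem _]

/-- The constant term in `x_p` fills in row `p` of the arrays. -/
theorem CT_partialCT {n : ℕ} (p : Fin n) :
    CT (some p) (partialCT n p) = partialCT n (p + 1) := by
  have hge : (Finset.univ.filter fun j : Fin n => p.val ≤ j.val) = insert p (Finset.Ioi p) := by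
    ext j
    simp only [Finset.mem_filter, Finset.mem_univ, true_and, Finset.mem_insert, Finset.mem_Ioi,
      Fin.ext_iff, Fin.lt_def]
    omega
  have hgt : (Finset.univ.filter fun j : Fin n => p.val + 1 ≤ j.val) = Finset.Ioi p := by
    ext j
    simp only [Finset.mem_filter, Finset.mem_univ, true_and, Finset.mem_Ioi, Fin.lt_def]
    omega
  have hlt : (Finset.univ.filter fun j : Fin n => j.val < p.val) = Finset.Iio p := by
    ext j
    simp only [Finset.mem_filter, Finset.mem_univ, true_and, Finset.mem_Iio, Fin.lt_def]
  have hle : (Finset.univ.filter fun j : Fin n => j.val < p.val + 1) =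
      insert p (Finset.Iio p) := by
    ext j
    simp only [Finset.mem_filter, Finset.mem_univ, true_and, Finset.mem_insert, Finset.mem_Iio,
      Fin.ext_iff, Fin.lt_def]
    omega
  have hIoi : p ∉ Finset.Ioi p := by simp
  have hIio : p ∉ Finset.Iio p := by simp
  rw [partialCT, CT_sum, partialCT, partialArrays, dif_pos p.2, Finset.sum_biUnion]
  · refine Finset.sum_congr rfl fun a ha => ?_
    rw [Finset.sum_image fun b _ b' _ h => by simpa using congrFun h p]
    have hc : (∏ i ∈ Finset.Iio p, diagWeight n (a i i)) *
        ∏ j ∈ Finset.Ioi p, remainingFactor p.val a j ∈ constField (some p) :=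
      mul_mem (prod_mem fun i _ => diagWeight_mem_constField p _) (prod_mem fun j hj =>
        remainingFactor_mem_constField _ _ (Finset.mem_Ioi.mp hj))
    rw [hge, Finset.prod_insert hIoi, hgt, hlt, mul_left_comm, mul_comm (remainingFactor _ _ _),
      CT_mul_left hc, remainingFactor, CT_row, hlt, Finset.mul_sum]
    refine Finset.sum_congr rfl fun b _ => ?_
    have hup : ∀ i ∈ Finset.Iio p, Function.update a p b i = a i := fun i hi =>
      Function.update_of_ne (Finset.mem_Iio.mp hi).ne _ _
    have hdiag : ∏ i ∈ Finset.Iio p, diagWeight n (Function.update a p b i i) =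
        ∏ i ∈ Finset.Iio p, diagWeight n (a i i) :=
      Finset.prod_congr rfl fun i hi => by rw [hup i hi]
    have hrem : ∀ j, remainingFactor (p.val + 1) (Function.update a p b) j =
        remainingFactor p.val a j * (var (some j))⁻¹ ^ (1 + b j) := by
      intro j
      have hs : ∑ i ∈ Finset.Iio p, Function.update a p b i j = ∑ i ∈ Finset.Iio p, a i j :=
        Finset.sum_congr rfl fun i hi => by rw [hup i hi]
      rw [remainingFactor, remainingFactor, hle, hlt, Finset.sum_insert hIio, hs,
        Function.update_self, show p.val + 1 + (b j + ∑ i ∈ Finset.Iio p, a i j) =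
          p.val + ∑ i ∈ Finset.Iio p, a i j + (1 + b j) by ring, pow_add _ _ (1 + b j)]
      ring
    rw [hle, Finset.prod_insert hIio, Fin.eta, hdiag, Function.update_self,
      Finset.prod_congr rfl fun j _ => hrem j, Finset.prod_mul_distrib]
    ring
  · -- The rows before `p` of an array obtained by filling in row `p` determine the original array.
    intro a ha a' ha' haa
    rw [Function.onFun, Finset.disjoint_left]
    intro x hx hx'
    obtain ⟨b, -, rfl⟩ := Finset.mem_image.mp hx
    obtain ⟨b', -, h⟩ := Finset.mem_image.mp hx'
    refine haa (funext fun i => ?_)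
    by_cases hi : i = p
    · subst hi
      funext j
      rw [((mem_partialArrays _ _).mp ha).1 i j (Or.inr le_rfl),
        ((mem_partialArrays _ _).mp ha').1 i j (Or.inr le_rfl)]
    · have := congrFun h i
      simpa [Function.update_of_ne hi] using this.symm

theorem iterCT_integrand_eq_sum (n : ℕ) :
    iterCT (integrand n) = ∑ a ∈ partialArrays n n, ∏ i, diagWeight n (a i i) := by
  have h : ∀ m ≤ n, ((List.finRange n).take m).foldl (fun g i => CT (some i) g) (integrand n) =
      partialCT n m := by
    intro m
    induction m with
    | zero => simp [partialCT_zero]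
    | succ m ih =>
      intro hm
      have hl : m < (List.finRange n).length := by simpa using hm
      rw [← List.take_concat_get' _ _ hl, List.foldl_append, ih (by omega)]
      simpa using CT_partialCT (⟨m, hm⟩ : Fin n)
  have := h n le_rfl
  rw [List.take_of_length_le (by simp)] at this
  rw [iterCT, this, partialCT]
  refine Finset.sum_congr rfl fun a _ => ?_
  rw [Finset.filter_true_of_mem fun i _ => i.2, Finset.filter_false_of_mem fun i _ =>
    not_le.mpr i.2, Finset.prod_empty, mul_one]

end RatField

/-! ### The recurrence in the number of diagonal zeros -/

/-- The number of zeros on the diagonal of an array. -/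
def diagZeros {n : ℕ} (a : Fin n → Fin n → ℕ) : ℕ := (Finset.univ.filter fun i => a i i = 0).card

/-- The finite set of all triangular arrays of size `n`. -/
abbrev arrayFinset (n : ℕ) : Finset (Fin n → Fin n → ℕ) := RatField.partialArrays n n

theorem mem_arrayFinset {n : ℕ} {a : Fin n → Fin n → ℕ} :
    a ∈ arrayFinset n ↔ a ∈ triangularArrays n := by
  rw [RatField.mem_partialArrays]
  refine and_congr (forall₂_congr fun i j => ?_) (forall_congr' fun i => ?_)
  · exact imp_congr_left (or_iff_left (not_le.mpr i.2))
  · exact imp_iff_right i.2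

/-- The number of triangular arrays of size `n` with exactly `k` zeros on the diagonal. -/
def arrayCount (n k : ℕ) : ℕ := ((arrayFinset n).filter fun a => diagZeros a = k).card

theorem triangularArraysWithZeros_eq_coe (n k : ℕ) :
    triangularArraysWithZeros n k = ((arrayFinset n).filter fun a => diagZeros a = k) := by
  ext a
  simp only [Finset.coe_filter, mem_arrayFinset]
  rfl

theorem sum_ite_diagZeros (n k : ℕ) (c : ℚ) :
    ∑ a ∈ arrayFinset n, (if diagZeros a = k then c else 0) = c * arrayCount n k := by
  rw [← Finset.sum_filter, Finset.sum_const, arrayCount, nsmul_eq_mul, mul_comm]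

namespace RatField

theorem iterCT_integrand_eq_sum_pow (n : ℕ) :
    iterCT (integrand n) = ∑ a ∈ arrayFinset n, var none ^ diagZeros a := by
  rw [iterCT_integrand_eq_sum]
  refine Finset.sum_congr rfl fun a _ => ?_
  simp [diagWeight, Finset.prod_ite, diagZeros]

theorem euler_var_pow {σ : Type} (s : σ) (m : ℕ) :
    euler s (var s ^ m) = (m : RatField σ) * var s ^ m := by
  induction m with
  | zero => simp [euler_one]
  | succ m ih =>
    rw [pow_succ, euler_mul, ih, euler_var_self]
    push_cast
    ring

theorem transcendental_var {σ : Type} (s : σ) : Transcendental ℚ (var s) :=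
  (transcendental_algebraMap_iff (IsFractionRing.injective (MvPolynomial σ ℚ) (RatField σ))).mpr
    (MvPolynomial.transcendental_X ℚ s)

theorem CT_zpow_mul_pow {σ : Type} (s : σ) (k z : ℕ) :
    CT s (var s ^ (-(k : ℤ)) * var s ^ z) = if z = k then 1 else 0 := by
  have h : laurent s (var s ^ (-(k : ℤ)) * var s ^ z) = HahnSeries.single ((z : ℤ) - k) 1 := by
    rw [map_mul, map_zpow₀, map_pow, laurent_var_self, zpow_neg, zpow_natCast]
    rw [inv_mul_eq_iff_eq_mul₀ (pow_ne_zero _ (by simp)), HahnSeries.single_pow,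
      HahnSeries.single_pow, HahnSeries.single_mul_single]
    simp
  rw [CT, h, HahnSeries.coeff_single]
  simp only [sub_eq_zero, eq_comm, Nat.cast_inj]

theorem CT_none_iterCT_integrand (n k : ℕ) :
    CT none (var none ^ (-(k : ℤ)) * iterCT (integrand n)) =
      (arrayCount n k : RatField (Option (Fin n))) := by
  rw [iterCT_integrand_eq_sum_pow, Finset.mul_sum, CT_sum,
    Finset.sum_congr rfl fun a _ => CT_zpow_mul_pow none k (diagZeros a), arrayCount]
  simp

end RatField

open RatField in
/-- Comparison of the coefficients in the differential equation for the iterated constant term. -/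
theorem arrayCount_rec (n k : ℕ) :
    ((n : ℚ) - k) * (n - k + 1) * arrayCount n k = (k + 1) * k * arrayCount n (k + 1) := by
  have hode := iterCT_integrand_ode n _ rfl
  simp only [iterCT_integrand_eq_sum_pow, map_sum, euler_var_pow] at hode
  have hcast : ∀ m z : ℕ, euler none ((m : RatField (Option (Fin n))) * var none ^ z) =
      (m : RatField (Option (Fin n))) * ((z : RatField (Option (Fin n))) * var none ^ z) := by
    intro m z
    rw [← nsmul_eq_mul, map_nsmul, euler_var_pow, nsmul_eq_mul]
  simp only [hcast] at hode
  have hpoly : ∑ a ∈ arrayFinset n, (Polynomial.monomial (diagZeros a + 1)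
      (((n : ℚ) - diagZeros a) * (n - diagZeros a + 1)) - Polynomial.monomial (diagZeros a)
        ((diagZeros a : ℚ) ^ 2 - diagZeros a)) = 0 := by
    refine (transcendental_iff_injective.mp
      (transcendental_var (none : Option (Fin n)))) ?_
    rw [map_zero, map_sum, ← sub_eq_zero.mpr hode]
    simp only [Finset.mul_sum, ← Finset.sum_sub_distrib, ← Finset.sum_add_distrib]
    refine Finset.sum_congr rfl fun a _ => ?_
    rw [map_sub, Polynomial.aeval_monomial, Polynomial.aeval_monomial]
    simp only [eq_ratCast]
    push_cast
    ring
  have hcoeff := congrArg (fun p => Polynomial.coeff p (k + 1)) hpoly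
  simp only [Polynomial.finsetSum_coeff, Polynomial.coeff_sub, Polynomial.coeff_monomial,
    Polynomial.coeff_zero, Finset.sum_sub_distrib, Nat.add_right_cancel_iff] at hcoeff
  have e1 : ∑ a ∈ arrayFinset n, (if diagZeros a = k then
      ((n : ℚ) - diagZeros a) * (n - diagZeros a + 1) else 0) =
      ((n : ℚ) - k) * (n - k + 1) * arrayCount n k := by
    rw [← sum_ite_diagZeros]
    refine Finset.sum_congr rfl fun a _ => ?_
    split_ifs with h
    · rw [h]
    · rfl
  have e2 : ∑ a ∈ arrayFinset n, (if diagZeros a = k + 1 then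
      (diagZeros a : ℚ) ^ 2 - diagZeros a else 0) = (k + 1) * k * arrayCount n (k + 1) := by
    rw [← sum_ite_diagZeros]
    refine Finset.sum_congr rfl fun a _ => ?_
    split_ifs with h
    · rw [h]
      push_cast
      ring
    · rfl
  rw [e1, e2] at hcoeff
  exact sub_eq_zero.mp hcoeff

/-! ### Narayana numbers -/

theorem narayanaNumber_succ_rec (n k : ℕ) :
    ((n : ℚ) - (k + 1)) * (n - k) * narayanaNumber n (k + 1) =
      (k + 2) * (k + 1) * narayanaNumber n (k + 2) := by
  have h : ∀ m : ℕ, (n.choose (m + 1) : ℚ) * (m + 1) = n.choose m * (n - m) := by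
    intro m
    rcases le_or_gt m n with hm | hm
    · rw [← Nat.cast_sub hm]
      exact_mod_cast Nat.choose_succ_right_eq n m
    · rw [Nat.choose_eq_zero_of_lt hm, Nat.choose_eq_zero_of_lt (by omega)]
      simp
  have h1 := h k
  have h2 := h (k + 1)
  push_cast at h2
  rw [narayanaNumber, narayanaNumber]
  linear_combination (-(1 / n : ℚ) * n.choose (k + 1) * (n - (k + 1))) * h1 -
    ((1 / n : ℚ) * n.choose (k + 1) * (k + 1)) * h2

theorem narayanaNumber_one {n : ℕ} (hn : 1 ≤ n) : narayanaNumber n 1 = 1 := by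
  have : (n : ℚ) ≠ 0 := by positivity
  simp [narayanaNumber, this]

theorem narayanaNumber_self {n : ℕ} (hn : 1 ≤ n) : narayanaNumber n n = 1 := by
  obtain ⟨m, rfl⟩ := Nat.exists_eq_add_of_le' hn
  have : ((m : ℚ) + 1) ≠ 0 := by positivity
  simp [narayanaNumber, this]

/-- The Narayana numbers refine the Catalan numbers. -/
theorem sum_narayanaNumber {n : ℕ} (hn : 1 ≤ n) :
    ∑ k ∈ Finset.range (n + 1), narayanaNumber n k = 1 / ((n : ℚ) + 1) * (2 * n).choose n := by
  obtain ⟨m, rfl⟩ := Nat.exists_eq_add_of_le' hn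
  have hv : ∑ k ∈ Finset.range (m + 1), (m + 1).choose (k + 1) * (m + 1).choose k =
      (2 * (m + 1)).choose m := by
    rw [two_mul, Nat.add_choose_eq, Finset.Nat.sum_antidiagonal_eq_sum_range_succ_mk]
    refine Finset.sum_congr rfl fun k hk => ?_
    rw [mul_comm, ← Nat.choose_symm_of_eq_add (n := m + 1) (a := m - k) (b := k + 1)]
    have := Finset.mem_range.mp hk
    omega
  have hc := Nat.choose_succ_right_eq (2 * (m + 1)) m
  rw [show 2 * (m + 1) - m = m + 2 by omega] at hc
  rw [Finset.sum_range_succ']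
  simp only [narayanaNumber, mul_assoc, ← Finset.mul_sum, add_zero]
  have hv' : ∑ k ∈ Finset.range (m + 1), ((m + 1).choose (k + 1) : ℚ) * (m + 1).choose k =
      (2 * (m + 1)).choose m := by exact_mod_cast hv
  have hc' : ((2 * (m + 1)).choose (m + 1) : ℚ) * (m + 1) = (2 * (m + 1)).choose m * (m + 2) := by
    exact_mod_cast hc
  rw [hv']
  push_cast
  have h1 : ((m : ℚ) + 1) ≠ 0 := by positivity
  have h2 : ((m : ℚ) + 1 + 1) ≠ 0 := by positivity
  field_simp
  linear_combination -hc'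

theorem arrayCount_zero {n : ℕ} (hn : 1 ≤ n) : arrayCount n 0 = 0 := by
  have h := arrayCount_rec n 0
  have h1 : (n : ℚ) ≠ 0 := by positivity
  have h2 : (n : ℚ) + 1 ≠ 0 := by positivity
  simpa [h1, h2] using h

theorem arrayCount_eq_mul_one {n : ℕ} (hn : 1 ≤ n) (k : ℕ) :
    (arrayCount n k : ℚ) = narayanaNumber n k * arrayCount n 1 := by
  rcases k with _ | k
  · simp [arrayCount_zero hn, narayanaNumber]
  · induction k with
    | zero => rw [zero_add, narayanaNumber_one hn, one_mul]
    | succ k ih =>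
      have h1 := arrayCount_rec n (k + 1)
      have h2 := narayanaNumber_succ_rec n k
      push_cast at h1
      have h3 : ((k : ℚ) + 2) * (k + 1) ≠ 0 := by positivity
      refine mul_left_cancel₀ h3 ?_
      linear_combination -h1 + (n - (k + 1)) * (n - k : ℚ) * ih + arrayCount n 1 * h2

theorem arrayCount_eq_mul_self {n : ℕ} (hn : 1 ≤ n) (k : ℕ) :
    (arrayCount n k : ℚ) = narayanaNumber n k * arrayCount n n := by
  rw [arrayCount_eq_mul_one hn k, arrayCount_eq_mul_one hn n, narayanaNumber_self hn, one_mul]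

theorem card_arrayFinset_eq_sum (n : ℕ) :
    (arrayFinset n).card = ∑ k ∈ Finset.range (n + 1), arrayCount n k :=
  Finset.card_eq_sum_card_fiberwise fun a _ => by
    have : diagZeros a ≤ n := (Finset.card_le_univ _).trans (by simp)
    simpa using Nat.lt_succ_of_le this

/-! ### Arrays with zero diagonal -/

theorem diagZeros_eq_iff {n : ℕ} (a : Fin n → Fin n → ℕ) : diagZeros a = n ↔ ∀ i, a i i = 0 := by
  have := Finset.card_filter_eq_iff (s := (Finset.univ : Finset (Fin n))) (p := fun i => a i i = 0)
  rw [Finset.card_univ, Fintype.card_fin] at this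
  simpa [diagZeros] using this

/-- An array of size `n + 1` with its last column, without the corner entry, moved to the
diagonal. -/
def lastToDiag {n : ℕ} (a : Fin (n + 1) → Fin (n + 1) → ℕ) (i j : Fin n) : ℕ :=
  if i = j then a i.castSucc (Fin.last n) else a i.castSucc j.castSucc

/-- An array of size `n` with its diagonal moved to a new last column. -/
def diagToLast {n : ℕ} (b : Fin n → Fin n → ℕ) (i j : Fin (n + 1)) : ℕ :=
  Fin.lastCases (motive := fun _ => ℕ) 0
    (fun i => Fin.lastCases (motive := fun _ => ℕ) (b i i) (fun j => if i = j then 0 else b i j) j) i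

theorem lastToDiag_diagToLast {n : ℕ} (b : Fin n → Fin n → ℕ) :
    lastToDiag (diagToLast b) = b := by
  funext i j
  by_cases h : i = j
  · subst h
    simp [lastToDiag, diagToLast]
  · simp [lastToDiag, diagToLast, h]

theorem diagToLast_lastToDiag {n : ℕ} {a : Fin (n + 1) → Fin (n + 1) → ℕ}
    (ha : ∀ i j, j < i → a i j = 0) (hd : ∀ i, a i i = 0) : diagToLast (lastToDiag a) = a := by
  funext i j
  induction i using Fin.lastCases with
  | last =>
    rcases (Fin.le_last j).lt_or_eq with h | rfl
    · simp [diagToLast, ha _ _ h]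
    · simp [diagToLast, hd]
  | cast i =>
    induction j using Fin.lastCases with
    | last => simp [lastToDiag, diagToLast]
    | cast j =>
      by_cases h : i = j
      · subst h
        simp [diagToLast, hd]
      · simp [lastToDiag, diagToLast, h]

theorem sum_Ici_lastToDiag {n : ℕ} {a : Fin (n + 1) → Fin (n + 1) → ℕ} (hd : ∀ i, a i i = 0)
    (i : Fin n) :
    ∑ j ∈ Finset.Ici i, lastToDiag a i j = ∑ j ∈ Finset.Ici i.castSucc, a i.castSucc j := by
  have hins : ∀ {m : ℕ} (p : Fin m) (f : Fin m → ℕ),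
      ∑ j ∈ Finset.Ici p, f j = f p + ∑ j, if p < j then f j else 0 := by
    intro m p f
    rw [← Finset.Ioi_insert p, Finset.sum_insert (by simp), ← Finset.sum_filter]
    congr 2
    ext j
    simp
  rw [hins, hins, hd, Fin.sum_univ_castSucc, zero_add, if_pos (Fin.castSucc_lt_last i), add_comm]
  congr 1
  · refine Finset.sum_congr rfl fun j _ => ?_
    simp only [Fin.castSucc_lt_castSucc_iff]
    split_ifs with h
    · simp [lastToDiag, h.ne]
    · rfl
  · simp [lastToDiag]

theorem sum_Iio_lastToDiag {n : ℕ} (a : Fin (n + 1) → Fin (n + 1) → ℕ) (i : Fin n) :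
    ∑ j ∈ Finset.Iio i, lastToDiag a j i = ∑ j ∈ Finset.Iio i.castSucc, a j i.castSucc := by
  rw [← Fin.map_castSuccEmb_Iio, Finset.sum_map]
  refine Finset.sum_congr rfl fun j hj => ?_
  simp [lastToDiag, (Finset.mem_Iio.mp hj).ne]

theorem lastToDiag_mem_iff {n : ℕ} {a : Fin (n + 1) → Fin (n + 1) → ℕ}
    (ha : ∀ i j, j < i → a i j = 0) (hd : ∀ i, a i i = 0) :
    lastToDiag a ∈ triangularArrays n ↔ a ∈ triangularArrays (n + 1) := by
  constructor
  · rintro ⟨-, h⟩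
    refine ⟨ha, fun i => ?_⟩
    induction i using Fin.lastCases with
    | last =>
      have : Finset.Ici (Fin.last n) = {Fin.last n} := by
        ext j
        simp [Fin.last_le_iff]
      rw [this, Finset.sum_singleton, hd]
      exact Nat.zero_le _
    | cast i =>
      rw [← sum_Ici_lastToDiag hd, ← sum_Iio_lastToDiag]
      exact h i
  · rintro ⟨-, h⟩
    refine ⟨fun i j hij => ?_, fun i => ?_⟩
    · rw [lastToDiag, if_neg hij.ne']
      exact ha _ _ (by simpa using hij)
    · rw [sum_Ici_lastToDiag hd, sum_Iio_lastToDiag]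
      exact h i.castSucc

/-- Arrays of size `n + 1` with zero diagonal correspond to all arrays of size `n`. -/
theorem arrayCount_succ_self (n : ℕ) : arrayCount (n + 1) (n + 1) = (arrayFinset n).card := by
  refine Finset.card_bij' (fun a _ => lastToDiag a) (fun b _ => diagToLast b) ?_ ?_ ?_ ?_
  · intro a ha
    rw [Finset.mem_filter, mem_arrayFinset, diagZeros_eq_iff] at ha
    exact mem_arrayFinset.mpr ((lastToDiag_mem_iff ha.1.1 ha.2).mpr ha.1)
  · intro b hb
    rw [mem_arrayFinset] at hb
    have hd : ∀ i, diagToLast b i i = 0 := by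
      intro i
      induction i using Fin.lastCases <;> simp [diagToLast]
    have hz : ∀ i j, j < i → diagToLast b i j = 0 := by
      intro i j hij
      induction i using Fin.lastCases with
      | last => simp [diagToLast]
      | cast i =>
        induction j using Fin.lastCases with
        | last => exact absurd (Fin.le_last i.castSucc) (not_le.mpr hij)
        | cast j =>
          have hij' : j < i := by simpa using hij
          simp [diagToLast, hij'.ne', hb.1 i j hij']
    rw [Finset.mem_filter, mem_arrayFinset, diagZeros_eq_iff, ← lastToDiag_mem_iff hz hd,
      lastToDiag_diagToLast]
    exact ⟨hb, hd⟩
  · intro a ha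
    rw [Finset.mem_filter, mem_arrayFinset, diagZeros_eq_iff] at ha
    exact diagToLast_lastToDiag ha.1.1 ha.2
  · intro b _
    exact lastToDiag_diagToLast b

/-- The number of arrays of size `n` with zero diagonal is a product of Catalan numbers. -/
theorem arrayCount_self {n : ℕ} (hn : 1 ≤ n) :
    (arrayCount n n : ℚ) =
      ∏ i ∈ Finset.Icc 1 (n - 1), (1 / ((i : ℚ) + 1)) * ((2 * i).choose i : ℚ) := by
  induction n, hn using Nat.le_induction with
  | base =>
    rw [arrayCount_succ_self 0]
    simp [arrayFinset, RatField.partialArrays]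
  | succ n hn ih =>
    rw [arrayCount_succ_self, card_arrayFinset_eq_sum, Nat.cast_sum,
      Finset.sum_congr rfl fun k _ => arrayCount_eq_mul_self hn k, ← Finset.sum_mul,
      sum_narayanaNumber hn, ih]
    obtain ⟨m, rfl⟩ := Nat.exists_eq_add_of_le' hn
    rw [Nat.add_sub_cancel, Nat.add_sub_cancel, Finset.prod_Icc_succ_top (by omega), mul_comm]

theorem mainTheorem2 (n k : ℕ) (hn : 1 ≤ n) :
    RatField.CT none (RatField.var none ^ (-(k : ℤ)) * RatField.iterCT (RatField.integrand n)) =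
        algebraMap ℚ (RatField (Option (Fin n)))
          (narayanaNumber n k *
            ∏ i ∈ Finset.Icc 1 (n - 1), (1 / ((i : ℚ) + 1)) * ((2 * i).choose i : ℚ)) ∧
      (triangularArraysWithZeros n k).Finite ∧
      ((triangularArraysWithZeros n k).ncard : ℚ) =
        narayanaNumber n k *
          ∏ i ∈ Finset.Icc 1 (n - 1), (1 / ((i : ℚ) + 1)) * ((2 * i).choose i : ℚ) := by
  have hcount : (arrayCount n k : ℚ) = narayanaNumber n k *
      ∏ i ∈ Finset.Icc 1 (n - 1), (1 / ((i : ℚ) + 1)) * ((2 * i).choose i : ℚ) := by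
    rw [arrayCount_eq_mul_self hn, arrayCount_self hn]
  refine ⟨?_, ?_, ?_⟩
  · rw [RatField.CT_none_iterCT_integrand, ← hcount, map_natCast]
  · rw [triangularArraysWithZeros_eq_coe]
    exact Finset.finite_toSet _
  · rw [triangularArraysWithZeros_eq_coe, Set.ncard_coe_finset, ← hcount, arrayCount]
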